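/- For a finite group $G$, let $\mathsf{GEN}(G)$ be the impartial game in which two players alternately select previously unselected elements of $G$. The starting position is $\emptyset$, and the game ends as soon as the set of jointly selected elements generates $G$ (for trivial $G$, before the first move). The player who completes a generating set wins. Thus a position is a set $P\subseteq G$. It has no options if $\langle P\rangle=G$, and otherwise its options are the sets $P\cup\{g\}$ with $g\in G\setminus P$. The nim-number of a position is the least nonnegative integer that is not the nim-number of one of its options. We write $\mathsf{GEN}(G)=*n$ if the nim-number of the starting position is $n$. Let $d(G)=\min\{|S| : \langle S\rangle=G\}$, and let $\mathbb{Z}_n$ be the cyclic group of order $n$. **Theorem.** Let $G\cong T\times H$, where $T$ is a finite $2$-group and $H$ is a finite group of odd order. Then \[ \mathsf{GEN}(G)= \begin{cases} *1, & \text{if } |G| \text{ is odd and } d(G)\ge 3,\\ *1, & \text{if } G\cong\mathbb{Z}_{4k} \text{ for some } k\ge 1,\\ *1, & \text{if } G\cong\mathbb{Z}_2^2\times H \text{ and } d(H)\le 2,\\ *2, & \text{if } G\cong\mathbb{Z}_2,\\ *2, & \text{if } |G| \text{ is odd and } d(G)\in\{1,2\},\\ *4, & \text{if } G\cong\mathbb{Z}_{4k+2}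 \text{ for some } k\ge 1,\\ *0, & \text{otherwise.} \end{cases} \] Moreover, every finite nilpotent group $G$ is isomorphic to $T\times H$ for some subgroups $T,H\le G$ with $T$ a $2$-group and $|H|$ odd, so the formula applies to all finite nilpotent groups. -/

import Mathlib

namespace GenGame

/-- The minimal excludant: the least natural number that is not in `A`. It is only applied below to
finite sets `A`, whose complement is nonempty. -/
noncomputable def mex (A : Set ℕ) : ℕ := sInf Aᶜ

/-- The options of a position `P` (the set of elements selected so far) in the achievement game
`GEN(G)`: if `P` generates `G` then the game is over and there are none; otherwise the player to
move selects an element `g` that has not been selected before. -/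
def options {G : Type*} [Group G] (P : Set G) : Set (Set G) :=
  {Q | Subgroup.closure P ≠ ⊤ ∧ ∃ g : G, g ∉ P ∧ Q = insert g P}

theorem ncard_compl_lt_of_mem_options {G : Type*} [Group G] [Finite G] {P Q : Set G}
    (h : Q ∈ options P) : Qᶜ.ncard < Pᶜ.ncard := by
  obtain ⟨-, g, hg, rfl⟩ := h
  exact Set.ncard_lt_ncard (compl_lt_compl_iff_lt.2 (Set.ssubset_insert hg)) (Set.toFinite _)

/-- The nim-number (Sprague–Grundy value) of a position of `GEN(G)`: the minimal excludant of the
nim-numbers of its options. -/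
noncomputable def nim {G : Type*} [Group G] [Finite G] (P : Set G) : ℕ :=
  mex (Set.range fun Q : options P => nim Q.1)
termination_by Pᶜ.ncard
decreasing_by exact ncard_compl_lt_of_mem_options Q.2

/-- The nim-number of the game `GEN(G)`, that is, of its starting position, the empty set. -/
noncomputable def nimGEN (G : Type*) [Group G] [Finite G] : ℕ := nim (∅ : Set G)

/-- The cyclic group of order `n` (for `n ≥ 1`), written multiplicatively. -/
abbrev Z (n : ℕ) : Type := Multiplicative (ZMod n)

end GenGame

/-
Write `d(P)` for the number of further elements that a position `P` needs in order to generate `G`.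
Selecting an element of the subgroup `K(P)` generated by `P` and the Frattini subgroup does not
change `d(P)`, and such an element is available as soon as `|P|` and `|K(P)|` have different
parities. If the parity of `|K(Q)|` is the same for all `Q ⊇ P`, then induction shows that the
nim-number of `P` depends only on `d(P)` and on whether `|P|` has this parity.

For `|G|` odd this applies to the empty position, with odd parity. It also applies, with even
parity, if `t ^ 2 ≠ 1` for some `t ∈ T`, because the Frattini subgroup then contains `(t ^ 2, 1)`.
In the remaining case `T` is elementary abelian of some rank `r ≥ 1`. The first element selected
outside `H` makes `|K(P)|` even for the rest of the game and turns the deficiency into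
`max (r - 1) δ`, where `δ` is the deficiency of the projection of `P` to `H`; hence, by induction,
the nim-number of a position inside `H` depends only on `r`, `δ` and the parity of `|P|`.
-/

namespace GenGame

section Nim

theorem position_induction {α : Type*} [Finite α] {motive : Set α → Prop}
    (h : ∀ P, (∀ g ∉ P, motive (insert g P)) → motive P) (P : Set α) : motive P :=
  WellFoundedGT.induction P fun Q ih => h Q fun _ hg => ih _ (Set.ssubset_insert hg)

theorem even_ncard_insert {α : Type*} [Finite α] {P : Set α} {g : α} (hg : g ∉ P) :
    Even (insert g P).ncard ↔ ¬ Even P.ncard := by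
  rw [Set.ncard_insert_of_notMem hg (Set.toFinite _), Nat.even_add_one]

theorem mex_eq_of {A : Set ℕ} {n : ℕ} (h : ∀ m < n, m ∈ A) (hn : n ∉ A) : mex A = n :=
  le_antisymm (Nat.sInf_le hn) (not_lt.1 fun hlt => Nat.sInf_mem (s := Aᶜ) ⟨n, hn⟩ (h _ hlt))

variable {G : Type*} [Group G] [Finite G] {P : Set G}

theorem nim_eq_mex (P : Set G) :
    nim P = mex {m | Subgroup.closure P ≠ ⊤ ∧ ∃ g ∉ P, nim (insert g P) = m} := by
  rw [nim]
  congr 1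
  ext m
  constructor
  · rintro ⟨⟨Q, hP, g, hg, rfl⟩, hm⟩
    exact ⟨hP, g, hg, hm⟩
  · rintro ⟨hP, g, hg, hm⟩
    exact ⟨⟨insert g P, hP, g, hg, rfl⟩, hm⟩

theorem nim_of_closure_eq_top (h : Subgroup.closure P = ⊤) : nim P = 0 := by
  rw [nim_eq_mex]
  exact mex_eq_of (fun m hm => absurd hm m.not_lt_zero) fun h' => h'.1 h

theorem nim_eq_of (h : Subgroup.closure P ≠ ⊤) {n : ℕ}
    (hlt : ∀ m < n, ∃ g ∉ P, nim (insert g P) = m)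
    (hne : ∀ g ∉ P, nim (insert g P) ≠ n) : nim P = n := by
  rw [nim_eq_mex]
  exact mex_eq_of (fun m hm => ⟨h, hlt m hm⟩) fun ⟨_, g, hg, hn⟩ => hne g hg hn

theorem nim_image {G' : Type*} [Group G'] [Finite G'] (e : G ≃* G') (P : Set G) :
    nim (e '' P) = nim P := by
  induction P using position_induction with
  | h P ih =>
    have hcl : Subgroup.closure (e '' P) = ⊤ ↔ Subgroup.closure P = ⊤ := by
      rw [← MulEquiv.coe_toMonoidHom, ← MonoidHom.map_closure]
      exact map_eq_top_iff e.mapSubgroup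
    rw [nim_eq_mex, nim_eq_mex P]
    congr 1
    ext m
    refine and_congr (not_congr hcl) (e.surjective.exists.trans (exists_congr fun g => ?_))
    rw [e.injective.mem_set_image, ← Set.image_insert_eq]
    exact and_congr_right fun hg => by rw [ih g hg]

theorem nimGEN_congr {G' : Type*} [Group G'] [Finite G'] (e : G ≃* G') :
    nimGEN G = nimGEN G' := by
  rw [nimGEN, nimGEN, ← nim_image e, Set.image_empty]

end Nim

section Deficiency

variable {G : Type*} [Group G] {P Q : Set G} {g : G}

/-- The deficiency of a position: the number of further elements that have to be selected before
it generates `G`. -/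
noncomputable def deficiency (P : Set G) : ℕ :=
  sInf {n | ∃ S : Finset G, S.card = n ∧ Subgroup.closure (P ∪ S) = ⊤}

/-- The subgroup generated by a position `P` and the Frattini subgroup. Selecting an element of it
does not change the deficiency of `P`. -/
def hull (P : Set G) : Subgroup G := Subgroup.closure P ⊔ frattini G

theorem closure_le_hull (P : Set G) : Subgroup.closure P ≤ hull P := le_sup_left

theorem subset_hull (P : Set G) : P ⊆ hull P :=
  Subgroup.subset_closure.trans (closure_le_hull P)

theorem hull_mono (h : P ⊆ Q) : hull P ≤ hull Q :=
  sup_le_sup_right (Subgroup.closure_mono h) _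

theorem deficiency_le_card {S : Finset G} (h : Subgroup.closure (P ∪ S) = ⊤) :
    deficiency P ≤ S.card :=
  Nat.sInf_le ⟨S, rfl, h⟩

variable [Finite G]

theorem exists_card_eq_deficiency (P : Set G) :
    ∃ S : Finset G, S.card = deficiency P ∧ Subgroup.closure (P ∪ S) = ⊤ := by
  have := Fintype.ofFinite G
  exact Nat.sInf_mem
    (s := {n | ∃ S : Finset G, S.card = n ∧ Subgroup.closure (P ∪ S) = ⊤})
    ⟨_, Finset.univ, rfl, by simp⟩

theorem deficiency_empty : deficiency (∅ : Set G) = Group.rank G := by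
  obtain ⟨S, hS, hcl⟩ := exists_card_eq_deficiency (∅ : Set G)
  obtain ⟨R, hR, hcl'⟩ := Group.rank_spec G
  refine le_antisymm ?_ ?_
  · rw [← hR]
    exact deficiency_le_card (by rwa [Set.empty_union])
  · rw [← hS]
    exact Group.rank_le (by rwa [Set.empty_union] at hcl)

theorem deficiency_eq_zero_iff : deficiency P = 0 ↔ Subgroup.closure P = ⊤ := by
  constructor
  · intro h
    obtain ⟨S, hS, hcl⟩ := exists_card_eq_deficiency P
    rw [h, Finset.card_eq_zero] at hS
    rwa [hS, Finset.coe_empty, Set.union_empty] at hcl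
  · intro h
    exact Nat.le_zero.1 (deficiency_le_card (S := ∅) (by simpa using h))

theorem deficiency_le_succ_iff {n : ℕ} :
    deficiency P ≤ n + 1 ↔ ∃ g, deficiency (insert g P) ≤ n := by
  classical
  constructor
  · intro h
    obtain ⟨S, hS, hcl⟩ := exists_card_eq_deficiency P
    obtain rfl | ⟨g, hg⟩ := S.eq_empty_or_nonempty
    · refine ⟨1, (deficiency_eq_zero_iff.2 ?_).trans_le n.zero_le⟩
      exact top_le_iff.1 (hcl ▸ Subgroup.closure_mono (by simp))
    · refine ⟨g, (deficiency_le_card (S := S.erase g) ?_).trans ?_⟩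
      · rwa [Set.insert_union, ← Set.union_insert, ← Finset.coe_insert, Finset.insert_erase hg]
      · rw [Finset.card_erase_of_mem hg]
        omega
  · rintro ⟨g, hg⟩
    obtain ⟨S, hS, hcl⟩ := exists_card_eq_deficiency (insert g P)
    refine (deficiency_le_card (S := insert g S) ?_).trans
      ((Finset.card_insert_le g S).trans (by omega))
    rwa [Finset.coe_insert, Set.union_insert, ← Set.insert_union]

theorem deficiency_le_of_hull_le (h : hull P ≤ hull Q) : deficiency Q ≤ deficiency P := by
  obtain ⟨S, hS, hcl⟩ := exists_card_eq_deficiency P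
  rw [← hS]
  refine deficiency_le_card (frattini_nongenerating (top_le_iff.1 ?_))
  calc ⊤ = Subgroup.closure P ⊔ Subgroup.closure S := by rw [← Subgroup.closure_union, hcl]
    _ ≤ hull Q ⊔ Subgroup.closure S := sup_le_sup_right ((closure_le_hull P).trans h) _
    _ = Subgroup.closure (Q ∪ S) ⊔ frattini G := by
      rw [hull, Subgroup.closure_union, sup_right_comm]

theorem deficiency_congr (h : Subgroup.closure P = Subgroup.closure Q) :
    deficiency P = deficiency Q := by
  have : hull P = hull Q := congrArg (· ⊔ frattini G) h
  exact le_antisymm (deficiency_le_of_hull_le this.ge) (deficiency_le_of_hull_le this.le)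

theorem deficiency_anti (h : P ⊆ Q) : deficiency Q ≤ deficiency P :=
  deficiency_le_of_hull_le (hull_mono h)

theorem deficiency_insert_of_mem_hull (hg : g ∈ hull P) :
    deficiency (insert g P) = deficiency P := by
  refine le_antisymm (deficiency_anti (Set.subset_insert g P)) (deficiency_le_of_hull_le ?_)
  refine sup_le ((Subgroup.closure_le _).2 ?_) le_sup_right
  exact Set.insert_subset hg (subset_hull P)

theorem deficiency_le_deficiency_insert_add_one (g : G) (P : Set G) :
    deficiency P ≤ deficiency (insert g P) + 1 :=
  deficiency_le_succ_iff.2 ⟨g, le_rfl⟩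

theorem deficiency_insert_eq_or (g : G) (P : Set G) :
    deficiency (insert g P) = deficiency P ∨ deficiency (insert g P) = deficiency P - 1 := by
  have := deficiency_anti (Set.subset_insert g P)
  have := deficiency_le_deficiency_insert_add_one g P
  omega

theorem exists_deficiency_insert_eq_pred (P : Set G) :
    ∃ g, deficiency (insert g P) = deficiency P - 1 := by
  obtain ⟨g, hg⟩ := deficiency_le_succ_iff.1 (Nat.le_add_of_sub_le (le_refl (deficiency P - 1)))
  have := deficiency_le_deficiency_insert_add_one g P
  exact ⟨g, by omega⟩

theorem deficiency_image_le {G' : Type*} [Group G'] {f : G →* G'}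
    (hf : Function.Surjective f) (P : Set G) : deficiency (f '' P) ≤ deficiency P := by
  classical
  obtain ⟨S, hS, hcl⟩ := exists_card_eq_deficiency P
  rw [← hS]
  refine (deficiency_le_card (S := S.image f) ?_).trans Finset.card_image_le
  rw [Finset.coe_image, ← Set.image_union, ← MonoidHom.map_closure, hcl,
    Subgroup.map_top_of_surjective f hf]

theorem two_pow_deficiency_mul_card_closure_le (P : Set G) :
    2 ^ deficiency P * Nat.card (Subgroup.closure P) ≤ Nat.card G := by
  induction hn : deficiency P generalizing P with
  | zero => simpa using Subgroup.card_le_card_group _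
  | succ n ih =>
    obtain ⟨g, hg⟩ := exists_deficiency_insert_eq_pred P
    have hlt : Subgroup.closure P < Subgroup.closure (insert g P) := by
      refine (Subgroup.closure_mono (Set.subset_insert g P)).lt_of_ne fun h => ?_
      rw [← deficiency_congr h] at hg
      omega
    have hdouble : 2 * Nat.card (Subgroup.closure P) ≤
        Nat.card (Subgroup.closure (insert g P)) := by
      obtain ⟨k, hk⟩ := Subgroup.card_dvd_of_le hlt.le
      have hk1 : k ≠ 1 := by
        rintro rfl
        exact hlt.ne (Subgroup.eq_of_le_of_card_ge hlt.le (by omega))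
      have hk0 : k ≠ 0 := by
        rintro rfl
        exact Nat.card_pos.ne' hk
      rw [hk, mul_comm]
      exact Nat.mul_le_mul_left _ (by omega)
    calc 2 ^ (n + 1) * Nat.card (Subgroup.closure P)
        = 2 ^ n * (2 * Nat.card (Subgroup.closure P)) := by ring
      _ ≤ 2 ^ n * Nat.card (Subgroup.closure (insert g P)) := Nat.mul_le_mul_left _ hdouble
      _ ≤ Nat.card G := ih _ (by omega)

end Deficiency

section ConstantParity

variable {G : Type*} [Group G] {P : Set G}

/-- The nim-number of a position `P` of deficiency `d` such that `hull Q` has the same parity as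
`P` for all `Q ⊇ P`. -/
def alignedNim (d : ℕ) : ℕ := if d = 1 then 1 else 0

/-- The nim-number of a position `P` of deficiency `d` such that `hull Q` has the opposite parity
to `P` for all `Q ⊇ P`. -/
def misalignedNim (d : ℕ) : ℕ := if d = 0 then 0 else if d ≤ 2 then 2 else 1

theorem exists_mem_notMem_of_parity {K : Subgroup G} (hP : P ⊆ K)
    (h : ¬ (Even P.ncard ↔ Even (Nat.card K))) : ∃ g ∈ K, g ∉ P := by
  by_contra! hc
  obtain rfl : P = K := hP.antisymm hc
  exact h Iff.rfl

variable [Finite G]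

theorem nim_of_constant_parity (e : Prop) [Decidable e] (P : Set G)
    (he : ∀ Q, P ⊆ Q → (Even (Nat.card (hull Q)) ↔ e)) :
    nim P = if Even P.ncard ↔ e then alignedNim (deficiency P)
      else misalignedNim (deficiency P) := by
  induction P using position_induction with
  | h P ih =>
    by_cases hcl : Subgroup.closure P = ⊤
    · rw [nim_of_closure_eq_top hcl, deficiency_eq_zero_iff.2 hcl, alignedNim, misalignedNim,
        if_neg zero_ne_one, if_pos rfl, ite_self]
    have hd : deficiency P ≠ 0 := mt deficiency_eq_zero_iff.1 hcl
    have hoption : ∀ g ∉ P, nim (insert g P) =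
        if Even P.ncard ↔ e then misalignedNim (deficiency (insert g P))
        else alignedNim (deficiency (insert g P)) := fun g hg => by
      rw [ih g hg fun Q hQ => he Q ((Set.subset_insert g P).trans hQ)]
      simp only [even_ncard_insert hg, ← not_iff, ite_not]
    obtain ⟨x, hx⟩ := exists_deficiency_insert_eq_pred P
    have hxP : x ∉ P := fun h => by
      rw [Set.insert_eq_of_mem h] at hx
      omega
    split_ifs with hp
    · simp only [if_pos hp] at hoption
      refine nim_eq_of hcl (fun m hm => ⟨x, hxP, ?_⟩) fun g hg => ?_
      · rw [hoption x hxP, hx]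
        grind [alignedNim, misalignedNim]
      · rw [hoption g hg]
        grind [alignedNim, misalignedNim, deficiency_insert_eq_or g P]
    · simp only [if_neg hp] at hoption
      obtain ⟨s, hs, hsP⟩ := exists_mem_notMem_of_parity (subset_hull P)
        (by rwa [he P subset_rfl])
      have hs := deficiency_insert_of_mem_hull hs
      refine nim_eq_of hcl (fun m hm => ?_) fun g hg => ?_
      · have : m = alignedNim (deficiency P) ∨ m = alignedNim (deficiency P - 1) := by
          grind [alignedNim, misalignedNim]
        rcases this with rfl | rfl
        exacts [⟨s, hsP, by rw [hoption s hsP, hs]⟩, ⟨x, hxP, by rw [hoption x hxP, hx]⟩]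
      · rw [hoption g hg]
        grind [alignedNim, misalignedNim, deficiency_insert_eq_or g P]

theorem nimGEN_of_odd_card (hG : Odd (Nat.card G)) :
    nimGEN G = misalignedNim (Group.rank G) := by
  rw [nimGEN, nim_of_constant_parity False ∅ fun Q _ => ?_, Set.ncard_empty, deficiency_empty,
    if_neg (by simp)]
  rw [iff_false, Nat.not_even_iff_odd]
  exact hG.of_dvd_nat (Subgroup.card_subgroup_dvd_card _)

theorem nim_of_even_card_hull (hP : Even (Nat.card (hull P))) :
    nim P = if Even P.ncard then alignedNim (deficiency P) else misalignedNim (deficiency P) := by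
  rw [nim_of_constant_parity True P fun Q hQ => iff_true_intro ?_]
  · simp only [iff_true]
  · exact even_iff_two_dvd.2
      ((even_iff_two_dvd.1 hP).trans (Subgroup.card_dvd_of_le (hull_mono hQ)))

theorem nimGEN_of_even_card_frattini (hG : Even (Nat.card (frattini G))) :
    nimGEN G = alignedNim (Group.rank G) := by
  rw [nimGEN, nim_of_even_card_hull (by rwa [hull, Subgroup.closure_empty, bot_sup_eq]),
    Set.ncard_empty, if_pos Even.zero, deficiency_empty]

end ConstantParity

section Coprime

theorem coprime_card_of_isPGroup_two {T H : Type*} [Group T] [Finite T] (hT : IsPGroup 2 T)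
    (hH : Odd (Nat.card H)) : (Nat.card T).Coprime (Nat.card H) := by
  obtain ⟨n, hn⟩ := IsPGroup.iff_card.1 hT
  rw [hn]
  exact Nat.Coprime.pow_left n (Nat.coprime_two_left.2 hH)

variable {T H : Type*} [Group T] [Group H]

theorem mem_prod_of_coprime (hc : (Nat.card T).Coprime (Nat.card H)) {K : Subgroup (T × H)}
    {x : T × H} (hx : x ∈ K) : (x.1, (1 : H)) ∈ K ∧ ((1 : T), x.2) ∈ K := by
  obtain ⟨m, hmT, hmH⟩ := Nat.chineseRemainder hc 1 0
  have hpow : x ^ m = (x.1, (1 : H)) := by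
    refine Prod.ext ?_ ?_
    · rw [Prod.pow_fst, ← pow_mod_natCard x.1 m, hmT, pow_mod_natCard, pow_one]
    · rw [Prod.pow_snd, ← pow_mod_natCard x.2 m, hmH, pow_mod_natCard, pow_zero]
  have hfst : (x.1, (1 : H)) ∈ K := hpow ▸ K.pow_mem hx m
  have hsnd : (x.1, (1 : H))⁻¹ * x = ((1 : T), x.2) := by ext <;> simp
  exact ⟨hfst, hsnd ▸ K.mul_mem (K.inv_mem hfst) hx⟩

theorem eq_prod_map_of_coprime (hc : (Nat.card T).Coprime (Nat.card H))
    (K : Subgroup (T × H)) :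
    K = (K.map (MonoidHom.fst T H)).prod (K.map (MonoidHom.snd T H)) := by
  refine le_antisymm (fun x hx => ⟨⟨x, hx, rfl⟩, ⟨x, hx, rfl⟩⟩) ?_
  rintro ⟨t, h⟩ ⟨⟨x, hx, rfl⟩, ⟨y, hy, rfl⟩⟩
  simpa using mul_mem (mem_prod_of_coprime hc hx).1 (mem_prod_of_coprime hc hy).2

theorem closure_eq_prod_of_coprime (hc : (Nat.card T).Coprime (Nat.card H)) (P : Set (T × H)) :
    Subgroup.closure P =
      (Subgroup.closure (Prod.fst '' P)).prod (Subgroup.closure (Prod.snd '' P)) := by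
  rw [eq_prod_map_of_coprime hc (Subgroup.closure P), MonoidHom.map_closure,
    MonoidHom.map_closure]
  rfl

theorem deficiency_prod [Finite T] [Finite H] (hc : (Nat.card T).Coprime (Nat.card H))
    (P : Set (T × H)) :
    deficiency P = max (deficiency (Prod.fst '' P)) (deficiency (Prod.snd '' P)) := by
  suffices ∀ n, deficiency (Prod.fst '' P) ≤ n → deficiency (Prod.snd '' P) ≤ n →
      deficiency P ≤ n from
    le_antisymm (this _ (le_max_left _ _) (le_max_right _ _))
      (max_le (deficiency_image_le (f := MonoidHom.fst T H) Prod.fst_surjective P)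
        (deficiency_image_le (f := MonoidHom.snd T H) Prod.snd_surjective P))
  intro n
  induction n generalizing P with
  | zero =>
    simp only [Nat.le_zero, deficiency_eq_zero_iff]
    intro hT hH
    rw [closure_eq_prod_of_coprime hc, hT, hH, Subgroup.top_prod_top]
  | succ n ih =>
    simp only [deficiency_le_succ_iff]
    rintro ⟨t, ht⟩ ⟨h, hh⟩
    exact ⟨(t, h), ih _ (by rwa [Set.image_insert_eq]) (by rwa [Set.image_insert_eq])⟩

theorem even_card_of_mk_one_mem (hT : IsPGroup 2 T) {K : Subgroup (T × H)} {t : T}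
    (ht : t ≠ 1) (hK : (t, 1) ∈ K) : Even (Nat.card K) := by
  have hdvd : 2 ∣ orderOf (t, (1 : H)) := by
    rw [Prod.orderOf_mk, orderOf_one, Nat.lcm_one_right]
    exact hT.dvd_orderOf ht
  exact even_iff_two_dvd.2 (hdvd.trans (Subgroup.orderOf_dvd_natCard K hK))

end Coprime

section Frattini

theorem pow_mem_frattini {p : ℕ} [Fact p.Prime] {T : Type*} [Group T] [Finite T]
    (hT : IsPGroup p T) (t : T) : t ^ p ∈ frattini T := by
  simp only [frattini, Order.radical, Subgroup.mem_iInf]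
  intro M hM
  have := hT.isNilpotent
  have : M.Normal := Subgroup.NormalizerCondition.normal_of_coatom M
    Group.normalizerCondition_of_isNilpotent hM
  obtain ⟨n, hn⟩ := IsPGroup.iff_card.1 hT
  obtain ⟨m, hm⟩ := IsPGroup.iff_card.1 (hT.to_subgroup M)
  have hmn : m < n := by
    refine (Nat.pow_lt_pow_iff_right (Fact.out : p.Prime).one_lt).1 ?_
    rw [← hm, ← hn]
    exact (Subgroup.card_le_card_group M).lt_of_ne (mt M.eq_top_of_card_eq hM.1)
  obtain ⟨K, hK, hMK⟩ := Sylow.exists_subgroup_card_pow_succ (hn ▸ pow_dvd_pow p hmn) hm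
  have hKtop : K = ⊤ := hM.2 K (hMK.lt_of_ne fun h => by
    rw [← h, hm] at hK
    exact absurd hK (Nat.pow_lt_pow_right (Fact.out : p.Prime).one_lt m.lt_succ_self).ne)
  have hindex : M.index = p := by
    have := M.card_mul_index
    rw [hm, ← Subgroup.card_top, ← hKtop, hK, pow_succ] at this
    exact Nat.eq_of_mul_eq_mul_left (pow_pos (Fact.out : p.Prime).pos m) this
  exact hindex ▸ M.pow_index_mem t

theorem mk_one_mem_frattini {T H : Type*} [Group T] [Group H] [Finite T] {t : T}
    (ht : t ∈ frattini T) : (t, (1 : H)) ∈ frattini (T × H) := by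
  simp only [frattini, Order.radical, Subgroup.mem_iInf]
  intro M hM
  by_contra htM
  have hsup : M ⊔ (frattini T).prod ⊥ = ⊤ :=
    hM.2 _ (left_lt_sup.2 fun hle => htM (hle (Subgroup.mem_prod.2 ⟨ht, rfl⟩)))
  have : M.comap (MonoidHom.inl T H) = ⊤ := by
    refine frattini_nongenerating (top_le_iff.1 fun s _ => ?_)
    obtain ⟨x, hx, ⟨u, v⟩, ⟨hu, rfl⟩, hxu⟩ :=
      Subgroup.mem_sup_of_normal_right.1 (hsup ▸ Subgroup.mem_top (s, (1 : H)))
    obtain ⟨rfl, hx2⟩ : x.1 * u = s ∧ x.2 = 1 := by simpa [Prod.ext_iff] using hxu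
    exact Subgroup.mul_mem_sup (Subgroup.mem_comap.2 (by rwa [MonoidHom.inl_apply, ← hx2])) hu
  exact htM (Subgroup.mem_comap.1 (this ▸ Subgroup.mem_top t))

theorem nimGEN_prod_of_sq_ne_one {T H : Type*} [Group T] [Group H] [Finite T] [Finite H]
    (hT : IsPGroup 2 T) {t : T} (ht : t ^ 2 ≠ 1) :
    nimGEN (T × H) = alignedNim (Group.rank (T × H)) :=
  nimGEN_of_even_card_frattini
    (even_card_of_mk_one_mem hT ht (mk_one_mem_frattini (pow_mem_frattini hT t)))

end Frattini

section ExponentTwo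

variable {T : Type*} [Group T]

theorem isPGroup_two_of_exponent_two (hT : Monoid.exponent T = 2) : IsPGroup 2 T :=
  IsPGroup.of_exponent_dvd_pow (n := 1) (by simp [hT])

variable [Finite T]

theorem card_eq_two_pow_rank (hT : Monoid.exponent T = 2) : Nat.card T = 2 ^ Group.rank T := by
  let _ : CommGroup T := { ‹Group T› with mul_comm := mul_comm_of_exponent_two hT }
  refine le_antisymm (Nat.le_of_dvd (by positivity) (hT ▸ card_dvd_exponent_pow_rank T)) ?_
  simpa [deficiency_empty] using two_pow_deficiency_mul_card_closure_le (∅ : Set T)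

theorem deficiency_singleton_of_exponent_two (hT : Monoid.exponent T = 2) {t : T} (ht : t ≠ 1) :
    deficiency {t} = Group.rank T - 1 := by
  have hcard : 2 ≤ Nat.card (Subgroup.closure {t}) :=
    Finite.one_lt_card_iff_nontrivial.2 (Subgroup.nontrivial_iff_ne_bot _ |>.2 (by simpa))
  have hlt : deficiency {t} < Group.rank T := by
    refine (Nat.pow_lt_pow_iff_right one_lt_two).1 ?_
    calc 2 ^ deficiency {t} < 2 ^ deficiency {t} * 2 := by simp
      _ ≤ 2 ^ deficiency {t} * Nat.card (Subgroup.closure {t}) := Nat.mul_le_mul_left _ hcard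
      _ ≤ Nat.card T := two_pow_deficiency_mul_card_closure_le {t}
      _ = 2 ^ Group.rank T := card_eq_two_pow_rank hT
  have := deficiency_le_deficiency_insert_add_one t ∅
  rw [deficiency_empty, insert_empty_eq] at this
  omega

end ExponentTwo

section Inner

variable {T H : Type*} [Group T] {P : Set (T × H)} {g : T × H}

theorem closure_image_fst_of_inner (hP : ∀ x ∈ P, x.1 = 1) :
    Subgroup.closure (Prod.fst '' P) = ⊥ := by
  rw [Subgroup.closure_eq_bot_iff]
  rintro _ ⟨x, hx, rfl⟩
  exact hP x hx

variable [Group H]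

theorem exists_inner_mem_closure_notMem (hH : Odd (Nat.card H))
    (hP : ∀ x ∈ P, x.1 = 1) (heven : Even P.ncard) :
    ∃ g ∈ Subgroup.closure P, g ∉ P ∧ g.1 = 1 := by
  have hfst : ∀ x ∈ Subgroup.closure P, x.1 = 1 := fun x hx =>
    (Subgroup.closure_le (MonoidHom.fst T H).ker).2 hP hx
  have hinj : Function.Injective ((MonoidHom.snd T H).comp (Subgroup.closure P).subtype) :=
    fun x y hxy => Subtype.ext (Prod.ext ((hfst x x.2).trans (hfst y y.2).symm) hxy)
  have hodd : Odd (Nat.card (Subgroup.closure P)) :=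
    hH.of_dvd_nat (Subgroup.card_dvd_of_injective _ hinj)
  obtain ⟨g, hg, hgP⟩ := exists_mem_notMem_of_parity Subgroup.subset_closure
    (mt (·.1 heven) (Nat.not_even_iff_odd.2 hodd))
  exact ⟨g, hg, hgP, hfst g hg⟩

theorem closure_ne_top_of_inner [Nontrivial T] (hP : ∀ x ∈ P, x.1 = 1) :
    Subgroup.closure P ≠ ⊤ := by
  intro h
  have := congrArg (Subgroup.map (MonoidHom.fst T H)) h
  rw [MonoidHom.map_closure, Subgroup.map_top_of_surjective _ Prod.fst_surjective] at this
  exact bot_ne_top ((closure_image_fst_of_inner hP).symm.trans this)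

variable [Finite T] [Finite H]

theorem deficiency_insert_outer (hT : Monoid.exponent T = 2) (hH : Odd (Nat.card H))
    (hP : ∀ x ∈ P, x.1 = 1) (hg : g.1 ≠ 1) : deficiency (insert g P) =
      max (Group.rank T - 1) (deficiency (insert g.2 (Prod.snd '' P))) := by
  have hfst : deficiency (insert g.1 (Prod.fst '' P)) = Group.rank T - 1 := by
    rw [← deficiency_singleton_of_exponent_two hT hg]
    refine deficiency_congr ?_
    rw [Set.insert_eq, Subgroup.closure_union, closure_image_fst_of_inner hP, sup_bot_eq]
  rw [deficiency_prod (coprime_card_of_isPGroup_two (isPGroup_two_of_exponent_two hT) hH),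
    Set.image_insert_eq, Set.image_insert_eq, hfst]

theorem nim_insert_outer (hT : Monoid.exponent T = 2) (hH : Odd (Nat.card H))
    (hP : ∀ x ∈ P, x.1 = 1) (hg : g.1 ≠ 1) : nim (insert g P) =
      if Even P.ncard
      then misalignedNim (max (Group.rank T - 1) (deficiency (insert g.2 (Prod.snd '' P))))
      else alignedNim (max (Group.rank T - 1) (deficiency (insert g.2 (Prod.snd '' P)))) := by
  have hT2 := isPGroup_two_of_exponent_two hT
  have hhull : Even (Nat.card (hull (insert g P))) := even_card_of_mk_one_mem hT2 hg
    (mem_prod_of_coprime (coprime_card_of_isPGroup_two hT2 hH)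
      (subset_hull _ (Set.mem_insert g P))).1
  simp only [nim_of_even_card_hull hhull, even_ncard_insert (mt (hP g) hg), ite_not,
    deficiency_insert_outer hT hH hP hg]

/-- The nim-number of a position of even size inside the factor `H` of `T × H`, where `H` has odd
order and `T` is an elementary abelian `2`-group of rank `r`; `d` is the deficiency in `H`. -/
def innerEvenNim (r d : ℕ) : ℕ :=
  if r = 1 then if d = 0 then 2 else if d = 1 then 4 else 0
  else if r = 2 ∧ d ≤ 2 then 1 else 0

/-- The analogue of `innerEvenNim` for positions of odd size. -/
def innerOddNim (r d : ℕ) : ℕ :=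
  if r = 1 then if d = 0 then 1 else if d = 1 then 3 else if d = 2 then 2 else 1
  else if r = 2 then if d ≤ 1 then 0 else if d ≤ 3 then 2 else 1
  else 1

theorem nim_eq_of_inner [Nontrivial T] (hH : Odd (Nat.card H)) (hP : ∀ x ∈ P, x.1 = 1)
    {d n : ℕ} {inner outer : ℕ → ℕ} (hd : deficiency (Prod.snd '' P) = d)
    (hinner : ∀ g ∉ P, g.1 = 1 →
      nim (insert g P) = inner (deficiency (insert g.2 (Prod.snd '' P))))
    (houter : ∀ g : T × H, g.1 ≠ 1 →
      nim (insert g P) = outer (deficiency (insert g.2 (Prod.snd '' P))))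
    (hlt : ∀ m < n, m = outer d ∨ m = outer (d - 1) ∨
      d ≠ 0 ∧ m = inner (d - 1) ∨ Even P.ncard ∧ m = inner d)
    (hne : ∀ d', d' = d ∨ d' = d - 1 → outer d' ≠ n ∧ inner d' ≠ n) : nim P = n := by
  obtain ⟨t, ht⟩ := exists_ne (1 : T)
  obtain ⟨h, hh⟩ := exists_deficiency_insert_eq_pred (Prod.snd '' P)
  refine nim_eq_of (closure_ne_top_of_inner hP) (fun m hm => ?_) fun g hg => ?_
  · rcases hlt m hm with rfl | rfl | ⟨hd0, rfl⟩ | ⟨heven, rfl⟩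
    · refine ⟨(t, 1), mt (hP _) ht, ?_⟩
      rw [houter _ ht, deficiency_insert_of_mem_hull (one_mem _), hd]
    · exact ⟨(t, h), mt (hP _) ht, by rw [houter _ ht, hh, hd]⟩
    · have hhP : (1, h) ∉ P := fun hmem => by
        rw [Set.insert_eq_of_mem (Set.mem_image_of_mem Prod.snd hmem)] at hh
        omega
      exact ⟨(1, h), hhP, by rw [hinner _ hhP rfl, hh, hd]⟩
    · obtain ⟨g, hgcl, hgP, hg1⟩ := exists_inner_mem_closure_notMem hH hP heven
      have hg2 : g.2 ∈ hull (Prod.snd '' P) := closure_le_hull _ <| by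
        rw [← MonoidHom.coe_snd, ← MonoidHom.map_closure]
        exact Subgroup.mem_map_of_mem _ hgcl
      exact ⟨g, hgP, by rw [hinner g hgP hg1, deficiency_insert_of_mem_hull hg2, hd]⟩
  · have hg' := hne _ (hd ▸ deficiency_insert_eq_or g.2 (Prod.snd '' P))
    by_cases hg1 : g.1 = 1
    · exact hinner g hg hg1 ▸ hg'.2
    · exact houter g hg1 ▸ hg'.1

theorem nim_of_inner (hT : Monoid.exponent T = 2) (hH : Odd (Nat.card H))
    (hP : ∀ x ∈ P, x.1 = 1) : nim P =
      if Even P.ncard then innerEvenNim (Group.rank T) (deficiency (Prod.snd '' P))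
      else innerOddNim (Group.rank T) (deficiency (Prod.snd '' P)) := by
  have : Nontrivial T := by
    rw [← not_subsingleton_iff_nontrivial, ← Monoid.exp_eq_one_iff]
    omega
  have hr := (Group.rank_pos T).ne'
  induction P using position_induction with
  | h P ih =>
    have houter := fun g hg => nim_insert_outer (g := g) hT hH hP hg
    have hinner : ∀ g ∉ P, g.1 = 1 → nim (insert g P) =
        if Even P.ncard
        then innerOddNim (Group.rank T) (deficiency (insert g.2 (Prod.snd '' P)))
        else innerEvenNim (Group.rank T) (deficiency (insert g.2 (Prod.snd '' P))) :=
      fun g hg hg1 => by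
        have hgP : ∀ x ∈ insert g P, x.1 = 1 := by
          rintro x (rfl | hx)
          exacts [hg1, hP x hx]
        simpa only [even_ncard_insert hg, ite_not, Set.image_insert_eq] using ih g hg hgP
    split_ifs with heven
    · simp only [if_pos heven] at hinner houter
      refine nim_eq_of_inner (inner := innerOddNim (Group.rank T))
        (outer := fun d => misalignedNim (max (Group.rank T - 1) d))
        hH hP rfl hinner houter ?_ ?_ <;> grind [innerEvenNim, innerOddNim, misalignedNim]
    · simp only [if_neg heven] at hinner houter
      refine nim_eq_of_inner (inner := innerEvenNim (Group.rank T))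
        (outer := fun d => alignedNim (max (Group.rank T - 1) d))
        hH hP rfl hinner houter ?_ ?_ <;> grind [innerEvenNim, innerOddNim, alignedNim]

theorem nimGEN_prod_of_exponent_two (hT : Monoid.exponent T = 2) (hH : Odd (Nat.card H)) :
    nimGEN (T × H) = innerEvenNim (Group.rank T) (Group.rank H) := by
  rw [nimGEN, nim_of_inner hT hH fun x hx => absurd hx (Set.notMem_empty x), Set.ncard_empty,
    if_pos Even.zero, Set.image_empty, deficiency_empty]

end Inner

section Classification

theorem card_Z (n : ℕ) : Nat.card (Z n) = n := Nat.card_zmod n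

theorem isCyclic_of_mulEquiv_Z {G : Type*} [Group G] {n : ℕ} (f : G ≃* Z n) : IsCyclic G :=
  f.isCyclic.2 inferInstance

theorem card_of_mulEquiv_Z {G : Type*} [Group G] {n : ℕ} (f : G ≃* Z n) : Nat.card G = n :=
  (Nat.card_congr f.toEquiv).trans (card_Z n)

theorem exponent_Z (n : ℕ) : Monoid.exponent (Z n) = n :=
  IsCyclic.exponent_eq_card.trans (card_Z n)

theorem nonempty_mulEquiv_Z_prod {G : Type*} [Group G] [IsCyclic G]
    {a b : ℕ} (hab : a.Coprime b) (hG : Nat.card G = a * b) : Nonempty (G ≃* Z a × Z b) := by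
  have : IsCyclic (Z a × Z b) :=
    Group.isCyclic_prod_iff.2 ⟨inferInstance, inferInstance, by rwa [card_Z, card_Z]⟩
  exact ⟨mulEquivOfCyclicCardEq (by rw [hG, Nat.card_prod, card_Z, card_Z])⟩

instance isKleinFour_Z_two_prod : IsKleinFour (Z 2 × Z 2) where
  card_four := by rw [Nat.card_prod, card_Z]
  exponent_two := by
    rw [Monoid.exponent_prod, exponent_Z]
    rfl

theorem isKleinFour_iff_rank_eq_two {T : Type*} [Group T] [Finite T]
    (hT : Monoid.exponent T = 2) : IsKleinFour T ↔ Group.rank T = 2 := by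
  have hcard := card_eq_two_pow_rank hT
  constructor
  · intro h
    rw [h.card_four] at hcard
    exact (Nat.pow_right_injective le_rfl hcard).symm
  · intro h
    rw [h] at hcard
    exact ⟨hcard, hT⟩

variable {G : Type*} [Group G] [Finite G]

theorem rank_le_one_iff_isCyclic : Group.rank G ≤ 1 ↔ IsCyclic G := by
  simp only [← deficiency_empty, deficiency_le_succ_iff, Nat.le_zero, deficiency_eq_zero_iff,
    insert_empty_eq, ← Subgroup.zpowers_eq_closure, isCyclic_iff_exists_zpowers_eq_top]

theorem rank_eq_one [Nontrivial G] [IsCyclic G] : Group.rank G = 1 :=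
  le_antisymm (rank_le_one_iff_isCyclic.2 ‹_›) (Group.rank_pos G)

theorem nonempty_mulEquiv_Z_of_even_card [IsCyclic G] (hG : Even (Nat.card G)) :
    (∃ k, 1 ≤ k ∧ Nonempty (G ≃* Z (4 * k))) ∨ Nonempty (G ≃* Z 2) ∨
      ∃ k, 1 ≤ k ∧ Nonempty (G ≃* Z (4 * k + 2)) := by
  have hZ : ∀ n, Nat.card G = n → Nonempty (G ≃* Z n) := fun n hn =>
    ⟨mulEquivOfCyclicCardEq (hn.trans (card_Z n).symm)⟩
  have hpos : 0 < Nat.card G := Nat.card_pos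
  obtain ⟨m, hm⟩ := hG
  rcases m.even_or_odd' with ⟨k, rfl | rfl⟩
  · exact Or.inl ⟨k, by omega, hZ _ (by omega)⟩
  · obtain rfl | hk := k.eq_zero_or_pos
    · exact Or.inr (Or.inl (hZ _ hm))
    · exact Or.inr (Or.inr ⟨k, hk, hZ _ (by omega)⟩)

theorem nimGEN_of_isCyclic_of_four_dvd_card [IsCyclic G] (h4 : 4 ∣ Nat.card G) :
    nimGEN G = 1 := by
  obtain ⟨a, m, hm, hG⟩ := Nat.exists_eq_two_pow_mul_odd (Nat.card_pos (α := G)).ne'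
  have : NeZero m := ⟨hm.pos.ne'⟩
  have h2m : Nat.Coprime 2 m := Nat.coprime_two_left.2 hm
  obtain ⟨e⟩ := nonempty_mulEquiv_Z_prod (h2m.pow_left a) hG
  obtain ⟨t, ht⟩ : ∃ t : Z (2 ^ a), t ^ 2 ≠ 1 := by
    rw [← not_forall, ← Monoid.exponent_dvd_iff_forall_pow_eq_one, exponent_Z]
    intro h2
    have := ((h2m.pow_left 2).dvd_of_dvd_mul_right (hG ▸ h4)).trans h2
    omega
  have : Nontrivial G := e.toEquiv.nontrivial_congr.2 ⟨(t ^ 2, 1), 1, by simpa [Prod.ext_iff]⟩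
  rw [nimGEN_congr e, nimGEN_prod_of_sq_ne_one (IsPGroup.of_card (card_Z (2 ^ a))) ht,
    ← Group.rank_congr e, rank_eq_one]
  rfl

theorem nimGEN_of_isCyclic_of_card_eq_two_mul [IsCyclic G] {m : ℕ} (hm : Odd m)
    (hG : Nat.card G = 2 * m) : nimGEN G = if m = 1 then 2 else 4 := by
  have : NeZero m := ⟨hm.pos.ne'⟩
  obtain ⟨e⟩ := nonempty_mulEquiv_Z_prod (Nat.coprime_two_left.2 hm) hG
  rw [nimGEN_congr e, nimGEN_prod_of_exponent_two (exponent_Z 2) (by rwa [card_Z]), rank_eq_one]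
  split_ifs with hm1
  · subst hm1
    have : Subsingleton (Z 1) := Finite.card_le_one_iff_subsingleton.1 (card_Z 1).le
    rw [Group.rank_eq_zero]
    rfl
  · have : Fact (1 < m) := ⟨by have := hm.pos; omega⟩
    rw [rank_eq_one]
    rfl

variable {T H : Type*} [Group T] [Group H] [Finite T] [Finite H]

theorem nimGEN_prod_of_isKleinFour [IsKleinFour T] (hH : Odd (Nat.card H))
    (hr : Group.rank H ≤ 2) : nimGEN (T × H) = 1 := by
  have hT := IsKleinFour.exponent_two (G := T)
  rw [nimGEN_prod_of_exponent_two hT hH, (isKleinFour_iff_rank_eq_two hT).1 ‹_›]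
  simp [innerEvenNim, hr]

theorem subsingleton_or_exponent_eq_two_or_exists_sq_ne_one (T : Type*) [Group T] :
    Subsingleton T ∨ Monoid.exponent T = 2 ∨ ∃ t : T, t ^ 2 ≠ 1 := by
  rw [← Monoid.exp_eq_one_iff, ← or_assoc, ← Nat.dvd_prime Nat.prime_two,
    Monoid.exponent_dvd_iff_forall_pow_eq_one, ← not_forall]
  exact em _

theorem odd_or_isCyclic_or_isKleinFour_of_nimGEN_ne_zero (hT : IsPGroup 2 T)
    (hH : Odd (Nat.card H)) (h0 : nimGEN (T × H) ≠ 0) :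
    Odd (Nat.card (T × H)) ∧ Group.rank (T × H) ≠ 0 ∨
      IsCyclic (T × H) ∧ Even (Nat.card (T × H)) ∨ IsKleinFour T ∧ Group.rank H ≤ 2 := by
  rcases subsingleton_or_exponent_eq_two_or_exists_sq_ne_one T with h1 | h2 | ⟨t, ht⟩
  · have hodd : Odd (Nat.card (T × H)) := by
      rwa [Nat.card_prod, Nat.card_of_subsingleton (1 : T), one_mul]
    rw [nimGEN_of_odd_card hodd] at h0
    exact Or.inl ⟨hodd, fun hr => h0 (by rw [hr]; rfl)⟩
  · rw [nimGEN_prod_of_exponent_two h2 hH] at h0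
    have hrank : Group.rank T = 1 ∧ Group.rank H ≤ 1 ∨ Group.rank T = 2 ∧ Group.rank H ≤ 2 := by
      grind [innerEvenNim]
    rcases hrank with ⟨hrT, hrH⟩ | ⟨hrT, hrH⟩
    · have hcyclic := Group.isCyclic_prod_iff.2 ⟨rank_le_one_iff_isCyclic.1 hrT.le,
        rank_le_one_iff_isCyclic.1 hrH, coprime_card_of_isPGroup_two hT hH⟩
      refine Or.inr (Or.inl ⟨hcyclic, ?_⟩)
      rw [Nat.card_prod, card_eq_two_pow_rank h2, hrT]
      exact even_two_mul _
    · exact Or.inr (Or.inr ⟨(isKleinFour_iff_rank_eq_two h2).2 hrT, hrH⟩)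
  · rw [nimGEN_prod_of_sq_ne_one hT ht] at h0
    have hrank : Group.rank (T × H) ≤ 1 := by
      grind [alignedNim]
    have heven := even_card_of_mk_one_mem hT ht (Subgroup.mem_top (t ^ 2, (1 : H)))
    rw [Subgroup.card_top] at heven
    exact Or.inr (Or.inl ⟨rank_le_one_iff_isCyclic.1 hrank, heven⟩)

end Classification

section Nilpotent

theorem isPGroup_pi {p : ℕ} [Fact p.Prime] {ι : Type*} [Finite ι] {F : ι → Type*}
    [∀ i, Group (F i)] [∀ i, Finite (F i)] (h : ∀ i, IsPGroup p (F i)) :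
    IsPGroup p (∀ i, F i) := by
  have := Fintype.ofFinite ι
  choose n hn using fun i => IsPGroup.iff_card.1 (h i)
  refine IsPGroup.of_card (n := ∑ i, n i) ?_
  rw [Nat.card_pi, Finset.prod_congr rfl fun i _ => hn i, Finset.prod_pow_eq_pow_sum]

theorem odd_card_pi {ι : Type*} [Finite ι] {F : ι → Type*} (h : ∀ i, Odd (Nat.card (F i))) :
    Odd (Nat.card (∀ i, F i)) := by
  have := Fintype.ofFinite ι
  rw [Nat.card_pi, ← Nat.coprime_two_left]
  exact Nat.Coprime.prod_right fun i _ => Nat.coprime_two_left.2 (h i)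

theorem exists_subgroup_mulEquiv_of_prod {G A B : Type*} [Group G] [Group A] [Group B]
    (e : G ≃* A × B) : ∃ T H : Subgroup G, Nonempty (A ≃* T) ∧ Nonempty (B ≃* H) :=
  ⟨_, _,
    ⟨MonoidHom.ofInjective (f := e.symm.toMonoidHom.comp (MonoidHom.inl A B))
      (e.symm.injective.comp fun _ _ h => (Prod.ext_iff.1 h).1)⟩,
    ⟨MonoidHom.ofInjective (f := e.symm.toMonoidHom.comp (MonoidHom.inr A B))
      (e.symm.injective.comp fun _ _ h => (Prod.ext_iff.1 h).2)⟩⟩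

theorem exists_mulEquiv_prod_of_isNilpotent (G : Type*) [Group G] [Finite G]
    [Group.IsNilpotent G] :
    ∃ T H : Subgroup G, IsPGroup 2 T ∧ Odd (Nat.card H) ∧ Nonempty (G ≃* T × H) := by
  obtain ⟨e⟩ := ((Group.isNilpotent_of_finite_tfae (G := G)).out 0 4).1 ‹_›
  let F : (Nat.card G).primeFactors → Type _ := fun p => ∀ P : Sylow p G, P
  let q : (Nat.card G).primeFactors → Prop := fun p => (p : ℕ) = 2
  let split : (∀ p, F p) ≃* (∀ p : {p // q p}, F p) × (∀ p : {p // ¬ q p}, F p) :=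
    { Equiv.piEquivPiSubtypeProd q F with map_mul' := fun _ _ => rfl }
  have htwo : IsPGroup 2 (∀ p : {p // q p}, F p) :=
    isPGroup_pi fun p => isPGroup_pi fun P => P.isPGroup'.mono p.2.dvd
  have hodd : Odd (Nat.card (∀ p : {p // ¬ q p}, F p)) :=
    odd_card_pi fun p => odd_card_pi fun P => by
      have hp := Nat.prime_of_mem_primeFactors p.1.2
      have : Fact p.1.1.Prime := ⟨hp⟩
      obtain ⟨n, hn⟩ := IsPGroup.iff_card.1 P.isPGroup'
      exact hn ▸ (hp.odd_of_ne_two p.2).pow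
  let f := e.symm.trans split
  obtain ⟨T, H, ⟨eT⟩, ⟨eH⟩⟩ := exists_subgroup_mulEquiv_of_prod f
  exact ⟨T, H, htwo.of_equiv eT, Nat.card_congr eH.toEquiv ▸ hodd, ⟨f.trans (eT.prodCongr eH)⟩⟩

end Nilpotent

end GenGame

/-- `Group.rank` is the minimum size `d` of a generating set. The first part computes `GEN(G)` for
every `G ≅ T × H` with `T` a finite `2`-group and `H` of odd order; the second part says that every
finite nilpotent group has this form. -/
theorem theorem4p9 :
    (∀ (G : Type*) (T : Type*) (H : Type*) [Group G] [Group T] [Group H]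
        [Finite G] [Finite T] [Finite H],
      IsPGroup 2 T → Odd (Nat.card H) → Nonempty (G ≃* T × H) →
      (Odd (Nat.card G) ∧ 3 ≤ Group.rank G → GenGame.nimGEN G = 1) ∧
      ((∃ k : ℕ, 1 ≤ k ∧ Nonempty (G ≃* GenGame.Z (4 * k))) → GenGame.nimGEN G = 1) ∧
      (Nonempty (G ≃* (GenGame.Z 2 × GenGame.Z 2) × H) ∧ Group.rank H ≤ 2 →
        GenGame.nimGEN G = 1) ∧
      (Nonempty (G ≃* GenGame.Z 2) → GenGame.nimGEN G = 2) ∧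
      (Odd (Nat.card G) ∧ (Group.rank G = 1 ∨ Group.rank G = 2) → GenGame.nimGEN G = 2) ∧
      ((∃ k : ℕ, 1 ≤ k ∧ Nonempty (G ≃* GenGame.Z (4 * k + 2))) → GenGame.nimGEN G = 4) ∧
      (¬ (Odd (Nat.card G) ∧ 3 ≤ Group.rank G) →
        ¬ (∃ k : ℕ, 1 ≤ k ∧ Nonempty (G ≃* GenGame.Z (4 * k))) →
        ¬ (Nonempty (G ≃* (GenGame.Z 2 × GenGame.Z 2) × H) ∧ Group.rank H ≤ 2) →
        ¬ Nonempty (G ≃* GenGame.Z 2) →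
        ¬ (Odd (Nat.card G) ∧ (Group.rank G = 1 ∨ Group.rank G = 2)) →
        ¬ (∃ k : ℕ, 1 ≤ k ∧ Nonempty (G ≃* GenGame.Z (4 * k + 2))) →
        GenGame.nimGEN G = 0)) ∧
    (∀ (G : Type*) [Group G] [Finite G] [Group.IsNilpotent G],
      ∃ T H : Subgroup G, IsPGroup 2 T ∧ Odd (Nat.card H) ∧ Nonempty (G ≃* T × H)) := by
  refine ⟨fun G T H _ _ _ _ _ _ hT hH ⟨e⟩ => ⟨?_, ?_, ?_, ?_, ?_, ?_, ?_⟩,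
    fun G _ _ _ => GenGame.exists_mulEquiv_prod_of_isNilpotent G⟩
  · rintro ⟨hodd, hr⟩
    rw [GenGame.nimGEN_of_odd_card hodd, GenGame.misalignedNim, if_neg (by omega),
      if_neg (by omega)]
  · rintro ⟨k, -, ⟨f⟩⟩
    have := GenGame.isCyclic_of_mulEquiv_Z f
    exact GenGame.nimGEN_of_isCyclic_of_four_dvd_card ⟨k, GenGame.card_of_mulEquiv_Z f⟩
  · exact fun ⟨⟨f⟩, hr⟩ =>
      (GenGame.nimGEN_congr f).trans (GenGame.nimGEN_prod_of_isKleinFour hH hr)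
  · rintro ⟨f⟩
    have := GenGame.isCyclic_of_mulEquiv_Z f
    exact GenGame.nimGEN_of_isCyclic_of_card_eq_two_mul odd_one (GenGame.card_of_mulEquiv_Z f)
  · rintro ⟨hodd, hr⟩
    rw [GenGame.nimGEN_of_odd_card hodd, GenGame.misalignedNim, if_neg (by omega),
      if_pos (by omega)]
  · rintro ⟨k, hk, ⟨f⟩⟩
    have := GenGame.isCyclic_of_mulEquiv_Z f
    have hcard : Nat.card G = 2 * (2 * k + 1) := (GenGame.card_of_mulEquiv_Z f).trans (by ring)
    rw [GenGame.nimGEN_of_isCyclic_of_card_eq_two_mul ⟨k, rfl⟩ hcard, if_neg (by omega)]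
  · intro hodd3 h4k hK h2 hodd12 h4k2
    by_contra h0
    rw [GenGame.nimGEN_congr e] at h0
    have hcases := GenGame.odd_or_isCyclic_or_isKleinFour_of_nimGEN_ne_zero hT hH h0
    rw [← Nat.card_congr e.toEquiv, ← Group.rank_congr e, ← e.isCyclic] at hcases
    rcases hcases with ⟨hodd, hr⟩ | ⟨hcyclic, heven⟩ | ⟨hT4, hr⟩
    · grind
    · exact (GenGame.nonempty_mulEquiv_Z_of_even_card heven).elim h4k (Or.elim · h2 h4k2)
    · obtain ⟨f⟩ := IsKleinFour.nonempty_mulEquiv (G₁ := T) (G₂ := GenGame.Z 2 × GenGame.Z 2)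
      exact hK ⟨⟨e.trans (f.prodCongr (MulEquiv.refl H))⟩, hr⟩
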